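/- Let $K$ be a field of characteristic $p \ge 0$ with $p \ne 2, 3$, let $C$ be a smooth, projective, geometrically irreducible curve over $K$, and let $F = K(C)$ be its function field. Let $E$ be an elliptic curve over $F$ with $j$-invariant $0$, and let $P \in E(F)$ be a point of infinite order. For $n \ge 1$ let $D_{nP}$ be the divisor on $C$ whose coefficient at each (normalized, discrete, trivial on $K$) valuation $v$ of $F$ is $$v(D_{nP}) = \max\{-\tfrac12 v(x_v(nP)),\, 0\},$$ where $x_v$ is the $x$-coordinate function of a $v$-minimal Weierstrass equation of $E$. Suppose that the pair $(E,P)$ is not constant, that is, there are no elliptic curve $\widetilde E$ over $K$ and isomorphism $\phi : E \to \widetilde E_F$ of elliptic curves over $F$ with $\phi(P) \in \widetilde E(K)$. Then the term $D_{3P}$ has a primitive valuation: there is a valuation $v$ of $F$ as above with $v(D_{3P}) > 0$ and $v(D_{P}) = v(D_{2P}) = 0$. -/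

import Mathlib

universe u v

open AlgebraicGeometry CategoryTheory

noncomputable section

namespace EllDiv

/-! ### Function fields of curves -/

section Curve

variable {K : Type u} [Field K]

/-- The inclusion of the constants `K` in the function field of an integral `K`-scheme. -/
def constants {C : Scheme.{u}} [IsIntegral C] (f : C ⟶ Spec (CommRingCat.of K)) :
    K →+* C.functionField :=
  ((C.presheaf.germ ⊤ (genericPoint C) trivial).hom.comp f.appTop.hom).comp
    (Scheme.ΓSpecIso (CommRingCat.of K)).inv.hom

/-- `F` is the function field `K(C)` of a smooth, projective, geometrically irreducible curve `C`
over `K`. (For a smooth curve over a field, proper and projective are the same thing; integrality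
follows from the other conditions and is listed so that `K(C)` is known to be a field.) -/
def IsFunctionFieldOfCurve (K : Type u) [Field K] (F : Type v) [Field F] [Algebra K F] : Prop :=
  ∃ (C : Scheme.{u}) (f : C ⟶ Spec (CommRingCat.of K)) (_ : IsIntegral C),
    IsProper f ∧ SmoothOfRelativeDimension 1 f ∧ GeometricallyIrreducible f ∧
      ∃ e : F ≃+* C.functionField, ∀ c : K, e (algebraMap K F c) = constants f c

end Curve

/-! ### Valuations of a function field -/

/-- A (normalized, discrete) valuation of `F` that is trivial on `K`, given by its valuation ring.
When `F = K(C)` these correspond to the closed points of `C`. -/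
structure Place (K : Type u) [Field K] (F : Type v) [Field F] [Algebra K F] where
  /-- the valuation ring -/
  ring : ValuationSubring F
  algebraMap_mem : ∀ c : K, algebraMap K F c ∈ ring
  isDVR : IsDiscreteValuationRing ring

section

variable {K : Type u} [Field K] {F : Type v} [Field F] [Algebra K F]

instance (v : Place K F) : IsDiscreteValuationRing v.ring := v.isDVR

/-- The normalized additive valuation of `x ≠ 0` (the value at `x = 0` is `0` by convention). -/
def Place.ord (v : Place K F) (x : F) : ℤ :=
  -WithZero.log
    (IsDedekindDomain.HeightOneSpectrum.valuation F
      (IsDiscreteValuationRing.maximalIdeal v.ring) x)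

/-! ### Isomorphisms of elliptic curves -/

/-- An admissible change of variables `x = u² x' + r`, `y = u³ y' + u² s x' + t` takes nonsingular
points of `W` to nonsingular points of the new curve. -/
theorem nonsingular_variableChange {W W' : WeierstrassCurve F}
    (φ : WeierstrassCurve.VariableChange F) (h : φ • W = W') {x y : F}
    (hP : W.toAffine.Nonsingular x y) :
    W'.toAffine.Nonsingular ((φ.u⁻¹ : Fˣ) ^ 2 * (x - φ.r))
      ((φ.u⁻¹ : Fˣ) ^ 3 * (y - φ.s * (x - φ.r) - φ.t)) := by
  subst h
  obtain ⟨u, r, s, t⟩ := φ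
  have hu : ((u⁻¹ : Fˣ) : F) ≠ 0 := (u⁻¹).ne_zero
  rw [WeierstrassCurve.Affine.nonsingular_iff'] at hP ⊢
  obtain ⟨hE, hN⟩ := hP
  rw [WeierstrassCurve.Affine.equation_iff'] at hE ⊢
  simp only [WeierstrassCurve.variableChange_def]
  generalize ((u⁻¹ : Fˣ) : F) = w at hu ⊢
  refine ⟨by linear_combination w ^ 6 * hE, ?_⟩
  contrapose! hN
  obtain ⟨hX, hY⟩ := hN
  have hY' : 2 * y + W.a₁ * x + W.a₃ = 0 := by
    refine (mul_eq_zero.mp (?_ : w ^ 3 * _ = 0)).resolve_left (pow_ne_zero 3 hu)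
    linear_combination hY
  refine ⟨(mul_eq_zero.mp (?_ : w ^ 4 * _ = 0)).resolve_left (pow_ne_zero 4 hu), hY'⟩
  linear_combination hX - w ^ 4 * s * hY'

/-- The isomorphism `W → W'` given by an admissible change of variables. -/
def mapPoint {W W' : WeierstrassCurve F} (φ : WeierstrassCurve.VariableChange F)
    (h : φ • W = W') : W.toAffine.Point → W'.toAffine.Point
  | .zero => .zero
  | .some _ _ hP => .some _ _ (nonsingular_variableChange φ h hP)

open scoped Classical in
/-- The pair `(E, P)` is constant: there are an elliptic curve `E'` over `K` and an isomorphism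
`φ : E → E'_F` over `F` such that `φ(P)` lies in `E'(K)`. -/
def IsConstantPair (K : Type u) [Field K] [Algebra K F] (W : WeierstrassCurve F)
    (P : W.toAffine.Point) : Prop :=
  ∃ (E' : WeierstrassCurve K) (_ : E'.IsElliptic) (φ : WeierstrassCurve.VariableChange F)
    (h : φ • W = E'.baseChange F),
    mapPoint φ h P ∈ Set.range (WeierstrassCurve.Affine.Point.baseChange (W' := E') K F)

/-! ### Elliptic divisibility sequences -/

/-- A change of variables to a `v`-minimal Weierstrass equation. -/
def toMinimal (W : WeierstrassCurve F) (v : Place K F) : WeierstrassCurve.VariableChange F :=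
  (W.exists_isMinimal v.ring).choose

/-- The coefficient `v(D_Q) = max {-v(x_v(Q)) / 2, 0}` at `v` of the divisor `D_Q`, where `x_v` is
the `x`-coordinate function of a `v`-minimal Weierstrass equation. When `x_v(Q) = 0` this is `0`;
at `Q = O`, where `x_v` has its pole, it is `⊤`. -/
def denom (W : WeierstrassCurve F) (Q : W.toAffine.Point) (v : Place K F) : WithTop ℚ :=
  match mapPoint (toMinimal W v) rfl Q with
  | .zero => ⊤
  | .some x _ _ => ((max (-(1 / 2 : ℚ) * (v.ord x : ℚ)) 0 : ℚ) : WithTop ℚ)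

/-- The valuation `v` is primitive in the term `D_n = D_{nP}`. -/
def IsPrimitiveValuation [DecidableEq F] (W : WeierstrassCurve F) (P : W.toAffine.Point) (n : ℕ)
    (v : Place K F) : Prop :=
  0 < denom W (n • P) v ∧ ∀ m : ℕ, 1 ≤ m → m < n → denom W (m • P) v = 0

end

end EllDiv

end

/-! A curve with j-invariant 0 has a model y² = x³ + a. If P = (x, y) has infinite order then x and
y are nonzero, and rescaling by u = y/x moves P to (c, c) on y² = x³ + c² - c³, where c = x³/y²
(`exists_diagonalCurve`). Thus c is the only parameter of the pair. The group law gives x(2P) - x(P)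
= (3/4)c(3c - 4), so 3P should meet O exactly where 3c = 4.

At a zero of 3c - 4 one has c ≡ 4/3 and 1 - c ≡ -1/3. Since 2 and 3 are invertible, the discriminant
-432c⁴(1 - c)² is a unit there, and integrality of x-coordinates can be tested on this model. P and
2P are integral, while x(3P) has a pole (`isPrimitiveValuation_three`).

It remains to find such a zero. If c is algebraic over K it lies in K, because the curve is
geometrically integral, and then the pair is constant. Otherwise some valuation ring has 3c - 4 in
its maximal ideal (`Place.exists_mem_nonunits`). It is discrete because F is finite separable over
K(x) whenever dx ≠ 0, so the ring is a localization of a Dedekind domain. -/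

namespace EllDiv

open WeierstrassCurve

/-! ### Changes of variables are group homomorphisms -/

section MapPoint

variable {F : Type v} [Field F]

theorem negY_variableChange (W : WeierstrassCurve F) (φ : VariableChange F) (x y : F) :
    (φ • W).toAffine.negY ((φ.u⁻¹ : Fˣ) ^ 2 * (x - φ.r))
      ((φ.u⁻¹ : Fˣ) ^ 3 * (y - φ.s * (x - φ.r) - φ.t)) =
    (φ.u⁻¹ : Fˣ) ^ 3 * (W.toAffine.negY x y - φ.s * (x - φ.r) - φ.t) := by
  simp only [Affine.negY, variableChange_a₁, variableChange_a₃]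
  ring

/-- The change of variables is affine, so it sends chords and tangents to chords and tangents. This
is what makes `mapPoint` additive. -/
theorem slope_variableChange [DecidableEq F] (W : WeierstrassCurve F) (φ : VariableChange F)
    {x₁ x₂ y₁ y₂ : F} (h₁ : W.toAffine.Equation x₁ y₁) (h₂ : W.toAffine.Equation x₂ y₂)
    (hxy : ¬(x₁ = x₂ ∧ y₁ = W.toAffine.negY x₂ y₂)) :
    (φ • W).toAffine.slope ((φ.u⁻¹ : Fˣ) ^ 2 * (x₁ - φ.r)) ((φ.u⁻¹ : Fˣ) ^ 2 * (x₂ - φ.r))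
      ((φ.u⁻¹ : Fˣ) ^ 3 * (y₁ - φ.s * (x₁ - φ.r) - φ.t))
      ((φ.u⁻¹ : Fˣ) ^ 3 * (y₂ - φ.s * (x₂ - φ.r) - φ.t)) =
    (φ.u⁻¹ : Fˣ) * (W.toAffine.slope x₁ x₂ y₁ y₂ - φ.s) := by
  have hw : ((φ.u⁻¹ : Fˣ) : F) ≠ 0 := (φ.u⁻¹).ne_zero
  by_cases hx : x₁ = x₂
  · subst hx
    have hy : y₁ ≠ W.toAffine.negY x₁ y₂ := fun h => hxy ⟨rfl, h⟩
    obtain rfl : y₁ = y₂ := Affine.Y_eq_of_Y_ne h₁ h₂ rfl hy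
    have hy' : (φ.u⁻¹ : Fˣ) ^ 3 * (y₁ - φ.s * (x₁ - φ.r) - φ.t) ≠
        (φ • W).toAffine.negY ((φ.u⁻¹ : Fˣ) ^ 2 * (x₁ - φ.r))
          ((φ.u⁻¹ : Fˣ) ^ 3 * (y₁ - φ.s * (x₁ - φ.r) - φ.t)) := by
      rw [negY_variableChange]
      intro h
      have := mul_left_cancel₀ (pow_ne_zero 3 hw) h
      exact hy (by linear_combination this)
    rw [Affine.slope_of_Y_ne rfl hy, Affine.slope_of_Y_ne rfl hy', negY_variableChange]
    have hd : y₁ - W.toAffine.negY x₁ y₁ ≠ 0 := sub_ne_zero.2 hy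
    rw [show (φ.u⁻¹ : Fˣ) ^ 3 * (y₁ - φ.s * (x₁ - φ.r) - φ.t) -
        (φ.u⁻¹ : Fˣ) ^ 3 * (W.toAffine.negY x₁ y₁ - φ.s * (x₁ - φ.r) - φ.t) =
        (φ.u⁻¹ : Fˣ) ^ 3 * (y₁ - W.toAffine.negY x₁ y₁) by ring]
    rw [div_eq_iff (mul_ne_zero (pow_ne_zero 3 hw) hd)]
    generalize hD : y₁ - W.toAffine.negY x₁ y₁ = D at hd ⊢
    simp only [Affine.negY] at hD
    simp only [variableChange_a₁, variableChange_a₂, variableChange_a₄]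
    generalize ((φ.u⁻¹ : Fˣ) : F) = w at hw ⊢
    have hq := div_mul_cancel₀ (3 * x₁ ^ 2 + 2 * W.a₂ * x₁ + W.a₄ - W.a₁ * y₁) hd
    generalize (3 * x₁ ^ 2 + 2 * W.a₂ * x₁ + W.a₄ - W.a₁ * y₁) / D = q at hq ⊢
    subst hD
    linear_combination -w ^ 4 * hq
  · have hx' : (φ.u⁻¹ : Fˣ) ^ 2 * (x₁ - φ.r) ≠ (φ.u⁻¹ : Fˣ) ^ 2 * (x₂ - φ.r) := fun h =>
      hx (by linear_combination mul_left_cancel₀ (pow_ne_zero 2 hw) h)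
    rw [Affine.slope_of_X_ne hx, Affine.slope_of_X_ne hx',
      div_eq_iff (sub_ne_zero.2 hx')]
    have hd : x₁ - x₂ ≠ 0 := sub_ne_zero.2 hx
    field_simp
    ring

theorem mapPoint_add [DecidableEq F] {W W' : WeierstrassCurve F} (φ : VariableChange F)
    (h : φ • W = W') (P Q : W.toAffine.Point) :
    mapPoint φ h (P + Q) = mapPoint φ h P + mapPoint φ h Q := by
  subst h
  rcases P with _ | ⟨x₁, y₁, h₁⟩
  · change mapPoint φ rfl (0 + Q) = 0 + _
    rw [zero_add, zero_add]
  rcases Q with _ | ⟨x₂, y₂, h₂⟩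
  · change mapPoint φ rfl (_ + 0) = _ + 0
    rw [add_zero, add_zero]
  have hw : ((φ.u⁻¹ : Fˣ) : F) ≠ 0 := (φ.u⁻¹).ne_zero
  by_cases hxy : x₁ = x₂ ∧ y₁ = W.toAffine.negY x₂ y₂
  · obtain ⟨rfl, rfl⟩ := hxy
    rw [Affine.Point.add_of_Y_eq rfl rfl]
    simp only [mapPoint]
    rw [Affine.Point.add_of_Y_eq rfl (negY_variableChange W φ _ _).symm]
    rfl
  · have hxy' : ¬((φ.u⁻¹ : Fˣ) ^ 2 * (x₁ - φ.r) = (φ.u⁻¹ : Fˣ) ^ 2 * (x₂ - φ.r) ∧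
        (φ.u⁻¹ : Fˣ) ^ 3 * (y₁ - φ.s * (x₁ - φ.r) - φ.t) = (φ • W).toAffine.negY
          ((φ.u⁻¹ : Fˣ) ^ 2 * (x₂ - φ.r)) ((φ.u⁻¹ : Fˣ) ^ 3 * (y₂ - φ.s * (x₂ - φ.r) - φ.t))) := by
      rw [negY_variableChange]
      rintro ⟨hx, hy⟩
      have hx := mul_left_cancel₀ (pow_ne_zero 2 hw) hx
      have hy := mul_left_cancel₀ (pow_ne_zero 3 hw) hy
      exact hxy ⟨by linear_combination hx, by linear_combination hy + φ.s * hx⟩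
    rw [Affine.Point.add_some hxy]
    simp only [mapPoint]
    rw [Affine.Point.add_some hxy']
    simp only [Affine.Point.some.injEq, slope_variableChange W φ h₁.1 h₂.1 hxy]
    simp only [Affine.addX, Affine.addY, Affine.negAddY, Affine.negY,
      variableChange_a₁, variableChange_a₂, variableChange_a₃]
    constructor <;> ring

theorem mapPoint_nsmul [DecidableEq F] {W W' : WeierstrassCurve F} (φ : VariableChange F)
    (h : φ • W = W') (n : ℕ) (P : W.toAffine.Point) :
    mapPoint φ h (n • P) = n • mapPoint φ h P := by
  induction n with
  | zero => rw [zero_smul, zero_smul]; rfl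
  | succ n ih => rw [succ_nsmul, succ_nsmul, mapPoint_add, ih]

theorem mapPoint_eq_zero_iff {W W' : WeierstrassCurve F} (φ : VariableChange F)
    (h : φ • W = W') (P : W.toAffine.Point) : mapPoint φ h P = 0 ↔ P = 0 := by
  rcases P with _ | ⟨x, y, h⟩
  · exact iff_of_true rfl rfl
  · exact iff_of_false (by rintro ⟨⟩) (by rintro ⟨⟩)

theorem mapPoint_mul {W W' W'' : WeierstrassCurve F} (φ ψ : VariableChange F)
    (h : φ • W = W') (h' : ψ • W' = W'') (h'' : (ψ * φ) • W = W'') (P : W.toAffine.Point) :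
    mapPoint (ψ * φ) h'' P = mapPoint ψ h' (mapPoint φ h P) := by
  rcases P with _ | ⟨x, y, hP⟩
  · rfl
  · have h₁ : (φ.u : F) ≠ 0 := φ.u.ne_zero
    have h₂ : (ψ.u : F) ≠ 0 := ψ.u.ne_zero
    simp only [mapPoint, VariableChange.mul_def, Affine.Point.some.injEq, mul_inv, Units.val_mul,
      Units.val_inv_eq_inv_val]
    constructor
    · field_simp
      ring
    · field_simp
      ring

end MapPoint

/-- The curve `y² = x³ + c² - c³`, which passes through `(c, c)`. -/
def diagonalCurve {R : Type*} [CommRing R] (c : R) : WeierstrassCurve R :=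
  ⟨0, 0, 0, 0, c ^ 2 - c ^ 3⟩

/-! ### The one-parameter normal form and the multiples 2P, 3P -/

section Diagonal

variable {F : Type v} [Field F]

theorem diagonalCurve_Δ {R : Type*} [CommRing R] (c : R) :
    (diagonalCurve c).Δ = -432 * (c ^ 2 - c ^ 3) ^ 2 := by
  simp only [WeierstrassCurve.Δ, b₂, b₄, b₆, b₈, diagonalCurve]
  ring

/-- The tangent at (c, c) has slope 3c²/(2c) = 3c/2. The coordinates are polynomials in c whose
denominators are powers of 2, hence integral wherever c and 1/2 are. -/
theorem two_nsmul_some [DecidableEq F] {c : F} (h : (diagonalCurve c).toAffine.Nonsingular c c)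
    (h2 : (2 : F) ≠ 0) (hc : c ≠ 0) :
    ∃ h', 2 • Affine.Point.some c c h =
      Affine.Point.some (9 / 4 * c ^ 2 - 2 * c) (9 / 2 * c ^ 2 - 27 / 8 * c ^ 3 - c) h' := by
  have hy : c ≠ (diagonalCurve c).toAffine.negY c c := by
    simp only [Affine.negY, diagonalCurve]
    intro h
    exact mul_ne_zero h2 hc (by linear_combination h)
  have hs : (diagonalCurve c).toAffine.slope c c c c = 3 / 2 * c := by
    rw [Affine.slope_of_Y_ne rfl hy, div_eq_iff (sub_ne_zero.2 hy)]
    simp only [Affine.negY, diagonalCurve]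
    field_simp
    ring
  have hxy : ¬(c = c ∧ c = (diagonalCurve c).toAffine.negY c c) := fun h => hy h.2
  have hX : (diagonalCurve c).toAffine.addX c c ((diagonalCurve c).toAffine.slope c c c c) =
      9 / 4 * c ^ 2 - 2 * c := by
    rw [hs]
    simp only [Affine.addX, diagonalCurve]
    rw [show (4 : F) = 2 * 2 by norm_num]
    field_simp
    ring
  have hY : (diagonalCurve c).toAffine.addY c c c ((diagonalCurve c).toAffine.slope c c c c) =
      9 / 2 * c ^ 2 - 27 / 8 * c ^ 3 - c := by
    rw [hs]
    simp only [Affine.addY, Affine.negAddY, Affine.negY, Affine.addX, diagonalCurve]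
    rw [show (8 : F) = 2 * 2 * 2 by norm_num]
    field_simp
    ring
  rw [two_nsmul, Affine.Point.add_some hxy]
  have := Affine.nonsingular_add h h hxy
  rw [hX, hY] at this
  refine ⟨this, ?_⟩
  simp only [Affine.Point.some.injEq]
  exact ⟨hX, hY⟩

/-- Expanding in powers of 3c - 4 exhibits the double pole of x(3P), with leading coefficient 64/9.
-/
theorem three_nsmul_some [DecidableEq F] {c : F} (h : (diagonalCurve c).toAffine.Nonsingular c c)
    (h2 : (2 : F) ≠ 0) (h3 : (3 : F) ≠ 0) (hc : c ≠ 0) (hc' : 3 * c - 4 ≠ 0) :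
    ∃ y h', 3 • Affine.Point.some c c h =
      Affine.Point.some (c + 64 / (9 * (3 * c - 4) ^ 2) + 8 * c / (3 * c - 4)) y h' := by
  obtain ⟨h₂, e⟩ := two_nsmul_some h h2 hc
  have h4 : (4 : F) ≠ 0 := by
    rw [show (4 : F) = 2 * 2 by norm_num]
    exact mul_ne_zero h2 h2
  -- This difference x(2P) - x(P) is the source of the factor 3c - 4: where it vanishes and c does
  -- not, 2P and -P coincide.
  have hd : 9 / 4 * c ^ 2 - 2 * c - c = 3 / 4 * c * (3 * c - 4) := by
    field_simp
    ring
  have hx : 9 / 4 * c ^ 2 - 2 * c ≠ c := by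
    rw [← sub_ne_zero, hd]
    exact mul_ne_zero (mul_ne_zero (div_ne_zero h3 h4) hc) hc'
  have hs : (diagonalCurve c).toAffine.slope (9 / 4 * c ^ 2 - 2 * c) c
      (9 / 2 * c ^ 2 - 27 / 8 * c ^ 3 - c) c = - 3 / 2 * c - 8 / (3 * (3 * c - 4)) := by
    rw [Affine.slope_of_X_ne hx, hd]
    obtain ⟨e, he⟩ : ∃ e, e = 3 * c - 4 := ⟨_, rfl⟩
    rw [← he] at hc' ⊢
    rw [show (4 : F) = 2 * 2 by norm_num, show (8 : F) = 2 * 2 * 2 by norm_num]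
    field_simp
    rw [he]
    ring
  have hX : (diagonalCurve c).toAffine.addX (9 / 4 * c ^ 2 - 2 * c) c
      ((diagonalCurve c).toAffine.slope (9 / 4 * c ^ 2 - 2 * c) c
      (9 / 2 * c ^ 2 - 27 / 8 * c ^ 3 - c) c) =
      c + 64 / (9 * (3 * c - 4) ^ 2) + 8 * c / (3 * c - 4) := by
    rw [hs]
    simp only [Affine.addX, diagonalCurve]
    generalize 3 * c - 4 = e at hc' ⊢
    rw [show (4 : F) = 2 * 2 by norm_num, show (9 : F) = 3 * 3 by norm_num]
    field_simp
    ring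
  have e₃ := succ_nsmul (Affine.Point.some c c h) 2
  rw [e, Affine.Point.add_of_X_ne hx] at e₃
  have := Affine.nonsingular_add h₂ h fun h => hx h.1
  refine ⟨_, hX ▸ this, e₃.trans ?_⟩
  simp only [Affine.Point.some.injEq]
  exact ⟨hX, trivial⟩

/-- A pair consisting of an elliptic curve of `j`-invariant `0` and a point of infinite order is
isomorphic to a curve `y² = x³ + c² - c³` with its point `(c, c)`. -/
theorem exists_diagonalCurve [DecidableEq F] (h2 : (2 : F) ≠ 0) (h3 : (3 : F) ≠ 0)
    (E : WeierstrassCurve F) [E.IsElliptic] (hj : E.j = 0) (P : E.toAffine.Point)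
    (hP : ¬ IsOfFinAddOrder P) :
    ∃ (c : F) (φ : VariableChange F) (h : φ • E = diagonalCurve c)
      (hc : (diagonalCurve c).toAffine.Nonsingular c c), c ≠ 0 ∧ c ≠ 1 ∧
        mapPoint φ h P = .some c c hc := by
  let _ : Invertible (2 : F) := invertibleOfNonzero h2
  let _ : Invertible (3 : F) := invertibleOfNonzero h3
  obtain ⟨φ, hφ⟩ := E.exists_variableChange_isShortNF
  have hP3 : ∀ n : ℕ, 0 < n → n • mapPoint φ rfl P ≠ 0 := by
    intro n hn h
    rw [← mapPoint_nsmul, mapPoint_eq_zero_iff] at h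
    exact hP (isOfFinAddOrder_iff_nsmul_eq_zero.2 ⟨n, hn, h⟩)
  have ha₁ := hφ.a₁
  have ha₂ := hφ.a₂
  have ha₃ := hφ.a₃
  have ha₄ : (φ • E).a₄ = 0 := by
    have h : (φ • E).c₄ = 0 := by
      rw [variableChange_c₄, (E.j_eq_zero_iff.1 hj), mul_zero]
    rw [c₄_of_isShortNF] at h
    refine (mul_eq_zero.1 h).resolve_left ?_
    rw [show (-48 : F) = -(2 * 2 * 2 * 2 * 3) by norm_num]
    simp [h2, h3]
  have hΔ : (φ • E).Δ ≠ 0 := (φ • E).isUnit_Δ.ne_zero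
  rw [Δ_of_isShortNF, ha₄] at hΔ
  have ha₆ : (φ • E).a₆ ≠ 0 := by
    intro h
    simp [h] at hΔ
  obtain ⟨x, y, hxy, e⟩ : ∃ x y hxy, mapPoint φ rfl P = .some x y hxy := by
    rcases hQ : mapPoint φ rfl P with _ | ⟨x, y, hxy⟩
    · exact absurd hQ (by rw [← one_nsmul (mapPoint φ rfl P)]; exact hP3 1 one_pos)
    · exact ⟨x, y, hxy, rfl⟩
  rw [e] at hP3
  have hEq : y ^ 2 = x ^ 3 + (φ • E).a₆ := by
    have := (Affine.equation_iff _ _).1 hxy.1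
    simp only [ha₁, ha₂, ha₃, ha₄] at this
    linear_combination this
  have hneg : (φ • E).toAffine.negY x y = -y := by
    simp only [Affine.negY, ha₁, ha₃]
    ring
  have hy : y ≠ 0 := by
    rintro rfl
    refine hP3 2 two_pos ?_
    rw [two_nsmul, Affine.Point.add_self_of_Y_eq]
    rw [hneg, neg_zero]
  have hyneg : y ≠ (φ • E).toAffine.negY x y := by
    rw [hneg]
    exact fun h => mul_ne_zero h2 hy (by linear_combination h)
  have hx : x ≠ 0 := by
    -- A point with x = 0 is a flex: its tangent is horizontal, so 2P = -P.
    rintro rfl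
    refine hP3 3 three_pos ?_
    have hs : (φ • E).toAffine.slope 0 0 y y = 0 := by
      rw [Affine.slope_of_Y_ne rfl hyneg]
      simp [ha₄]
    have h2P : 2 • Affine.Point.some 0 y hxy = -Affine.Point.some 0 y hxy := by
      rw [two_nsmul, Affine.Point.add_some fun h => hyneg h.2, Affine.Point.neg_some]
      simp [hs, Affine.addX, Affine.addY, Affine.negAddY, Affine.negY]
    rw [succ_nsmul _ 2, h2P, neg_add_cancel]
  -- The scale u = y/x is forced by x/u² = y/u³; the common value is x³/y².
  let ψ : VariableChange F := ⟨Units.mk0 (y / x) (div_ne_zero hy hx), 0, 0, 0⟩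
  have hψ : ψ • φ • E = diagonalCurve (x ^ 3 / y ^ 2) := by
    simp only [variableChange_def (C := ψ), ha₁, ha₂, ha₃, ha₄, diagonalCurve, ψ]
    have : (φ • E).a₆ = y ^ 2 - x ^ 3 := by rw [hEq]; ring
    simp only [this, WeierstrassCurve.mk.injEq, Units.val_inv_eq_inv_val, Units.val_mk0]
    refine ⟨by simp, by simp, by simp, by simp, ?_⟩
    field_simp
    ring
  have hψφ : (ψ * φ) • E = diagonalCurve (x ^ 3 / y ^ 2) := by rw [mul_smul, hψ]
  have hX : (ψ.u⁻¹ : Fˣ) ^ 2 * (x - ψ.r) = x ^ 3 / y ^ 2 := by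
    simp only [ψ, Units.val_inv_eq_inv_val, Units.val_mk0]
    field_simp
    ring
  have hY : (ψ.u⁻¹ : Fˣ) ^ 3 * (y - ψ.s * (x - ψ.r) - ψ.t) = x ^ 3 / y ^ 2 := by
    simp only [ψ, Units.val_inv_eq_inv_val, Units.val_mk0]
    field_simp
    ring
  have hns := nonsingular_variableChange ψ hψ hxy
  rw [hX, hY] at hns
  refine ⟨x ^ 3 / y ^ 2, ψ * φ, hψφ, hns, div_ne_zero (pow_ne_zero 3 hx) (pow_ne_zero 2 hy), ?_, ?_⟩
  · intro h
    rw [div_eq_one_iff_eq (pow_ne_zero 2 hy), hEq] at h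
    exact ha₆ (by linear_combination -h)
  · rw [mapPoint_mul φ ψ rfl hψ hψφ, e]
    simp only [mapPoint, Affine.Point.some.injEq]
    exact ⟨hX, hY⟩

end Diagonal

/-! ### Minimal models and the valuation at 3c = 4 -/

section Reduction

variable {K : Type u} [Field K] {F : Type v} [Field F] [Algebra K F]

theorem Place.valuation_le_one_iff (v : Place K F) (x : F) :
    IsDedekindDomain.HeightOneSpectrum.valuation F
      (IsDiscreteValuationRing.maximalIdeal v.ring) x ≤ 1 ↔ x ∈ v.ring := by
  constructor
  · intro h
    obtain ⟨r, rfl⟩ := IsDiscreteValuationRing.exists_lift_of_le_one h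
    exact r.2
  · intro h
    exact IsDedekindDomain.HeightOneSpectrum.valuation_le_one _ (⟨x, h⟩ : v.ring)

theorem Place.ord_neg_iff (v : Place K F) (x : F) : v.ord x < 0 ↔ x ∉ v.ring := by
  rw [← v.valuation_le_one_iff, not_le, Place.ord, neg_lt_zero]
  -- The convention `ord 0 = 0` is harmless here, since 0 lies in the valuation ring.
  by_cases hx : x = 0
  · simp [hx]
  · rw [WithZero.lt_log_iff_exp_lt, WithZero.exp_zero]
    rwa [ne_eq, map_eq_zero]

theorem Place.ord_nonneg_iff (v : Place K F) (x : F) : 0 ≤ v.ord x ↔ x ∈ v.ring := by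
  rw [← not_iff_not, not_le, v.ord_neg_iff]

/-- An admissible change of variables from a curve with integral coefficients, unit discriminant
and `b₂ = 0` to a minimal equation preserves integrality of `x`-coordinates. -/
theorem x_mem_iff_of_isMinimal (v : Place K F) (h2 : (2 : K) ≠ 0) (h3 : (3 : K) ≠ 0)
    {W W' : WeierstrassCurve F} (hW : WeierstrassCurve.IsIntegral v.ring W) (hb : W.b₂ = 0)
    (hΔ₀ : W.Δ ≠ 0) (hΔ' : W.Δ⁻¹ ∈ v.ring)
    (hW' : IsMinimal v.ring W') (ρ : VariableChange F) (hρ : ρ • W = W') (x : F) :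
    (ρ.u⁻¹ : Fˣ) ^ 2 * (x - ρ.r) ∈ v.ring ↔ x ∈ v.ring := by
  have hρ' : ρ⁻¹ • W' = W := by rw [← hρ, inv_smul_smul]
  have hΔ : IsDedekindDomain.HeightOneSpectrum.valuation F
      (IsDiscreteValuationRing.maximalIdeal v.ring) W.Δ = 1 := by
    obtain ⟨r, hr⟩ := Δ_integral_of_isIntegral v.ring W
    refine le_antisymm ((v.valuation_le_one_iff _).2 (hr ▸ r.2)) ?_
    rw [← v.valuation_le_one_iff, map_inv₀] at hΔ'
    exact (inv_le_one₀ (zero_lt_iff.2 ((map_ne_zero _).2 hΔ₀))).1 hΔ'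
  have key : IsDedekindDomain.HeightOneSpectrum.valuation F
      (IsDiscreteValuationRing.maximalIdeal v.ring) W'.Δ = 1 := by
    have hmax := hW'.val_Δ_maximal.2 (j := ρ⁻¹) (by simpa only [hρ'] using hW)
    simp only [hρ', one_smul] at hmax
    -- Maximality is only a conditional inequality; totality of the order removes the condition.
    -- Hence 1 = |Δ(W)| ≤ |Δ(W')| ≤ 1.
    have h := (le_total _ _).elim id hmax
    have h' : ((valuation_Δ_aux v.ring W : WithZero (Multiplicative ℤ))) ≤
      (valuation_Δ_aux v.ring W' : WithZero (Multiplicative ℤ)) := h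
    rw [valuation_Δ_aux_eq_of_isIntegral, valuation_Δ_aux_eq_of_isIntegral, hΔ] at h'
    refine le_antisymm ?_ h'
    rw [v.valuation_le_one_iff]
    obtain ⟨r, hr⟩ := Δ_integral_of_isIntegral v.ring W'
    rw [← hr]
    exact r.2
  -- Since Δ(W') = u⁻¹²Δ(W) and both are units, so is u.
  have hu : IsDedekindDomain.HeightOneSpectrum.valuation F
      (IsDiscreteValuationRing.maximalIdeal v.ring) ((ρ.u⁻¹ : Fˣ) : F) = 1 := by
    rw [← hρ, variableChange_Δ, map_mul, hΔ, mul_one, map_pow] at key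
    exact (pow_eq_one_iff_of_nonneg zero_le (by norm_num)).1 key
  have hu₁ : ((ρ.u⁻¹ : Fˣ) : F) ∈ v.ring := (v.valuation_le_one_iff _).1 hu.le
  have hu₂ : (ρ.u : F) ∈ v.ring := by
    rw [← v.valuation_le_one_iff]
    rw [Units.val_inv_eq_inv_val, map_inv₀, inv_eq_one] at hu
    exact hu.le
  have huu : (ρ.u : F) * ((ρ.u⁻¹ : Fˣ) : F) = 1 := ρ.u.mul_inv
  have h12 : (12 : F)⁻¹ ∈ v.ring := by
    have := v.algebraMap_mem (12 : K)⁻¹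
    rwa [map_inv₀, map_ofNat] at this
  have h12' : (12 : F) ≠ 0 := by
    have : (12 : K) ≠ 0 := by
      rw [show (12 : K) = 2 * 2 * 3 by norm_num]
      simp [h2, h3]
    simpa only [map_ofNat] using (map_ne_zero (algebraMap K F)).2 this
  -- With b₂ = 0 the new b₂ is 12u⁻²r; it is integral and 12 is a unit, so r is integral.
  have hr : ρ.r ∈ v.ring := by
    have hb' : W'.b₂ ∈ v.ring := by
      rw [← integralModel_b₂_eq v.ring W']
      exact ((integralModel v.ring W').b₂).2
    rw [← hρ, variableChange_b₂, hb, zero_add] at hb'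
    have : ρ.r = (12 : F)⁻¹ * ((ρ.u : F) ^ 2 * ((ρ.u⁻¹ : Fˣ) ^ 2 * (12 * ρ.r))) := by
      rw [← mul_assoc ((ρ.u : F) ^ 2), ← mul_pow, huu]
      field_simp
    rw [this]
    exact mul_mem h12 (mul_mem (pow_mem hu₂ 2) hb')
  constructor
  · intro h
    have : x = (ρ.u : F) ^ 2 * ((ρ.u⁻¹ : Fˣ) ^ 2 * (x - ρ.r)) + ρ.r := by
      rw [← mul_assoc, ← mul_pow, huu]
      ring
    rw [this]
    exact add_mem (mul_mem (pow_mem hu₂ 2) h) hr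
  · intro h
    exact mul_mem (pow_mem hu₁ 2) (sub_mem h hr)

theorem denom_eq_of_mapPoint (E : WeierstrassCurve F) {W : WeierstrassCurve F}
    (φ : VariableChange F) (h : φ • E = W) (Q : E.toAffine.Point) {x y : F}
    (hns : W.toAffine.Nonsingular x y) (hQ : mapPoint φ h Q = .some x y hns) (v : Place K F) :
    denom E Q v = ((max (-(1 / 2 : ℚ) * (v.ord (((toMinimal E v * φ⁻¹).u⁻¹ : Fˣ) ^ 2 *
      (x - (toMinimal E v * φ⁻¹).r)) : ℚ)) 0 : ℚ) : WithTop ℚ) := by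
  have hρ : (toMinimal E v * φ⁻¹) • W = toMinimal E v • E := by
    rw [← h, mul_smul, inv_smul_smul]
  have hφ : toMinimal E v * φ⁻¹ * φ = toMinimal E v := inv_mul_cancel_right _ _
  have e : mapPoint (toMinimal E v) rfl Q =
      mapPoint (toMinimal E v * φ⁻¹) hρ (mapPoint φ h Q) := by
    rw [← mapPoint_mul φ _ h hρ (by rw [hφ])]
    congr 1
    exact hφ.symm
  unfold denom
  rw [e, hQ]
  rfl

/-- Over a curve with integral coefficients, unit discriminant and `b₂ = 0`, the divisor `D_Q` is
read off from the given equation. -/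
theorem denom_of_mapPoint (h2 : (2 : K) ≠ 0) (h3 : (3 : K) ≠ 0)
    (E : WeierstrassCurve F) {W : WeierstrassCurve F}
    (φ : VariableChange F) (h : φ • E = W) (Q : E.toAffine.Point) {x y : F}
    (hns : W.toAffine.Nonsingular x y) (hQ : mapPoint φ h Q = .some x y hns) (v : Place K F)
    (hW : WeierstrassCurve.IsIntegral v.ring W) (hb : W.b₂ = 0)
    (hΔ₀ : W.Δ ≠ 0) (hΔ' : W.Δ⁻¹ ∈ v.ring) :
    (x ∈ v.ring → denom E Q v = 0) ∧ (x ∉ v.ring → 0 < denom E Q v) := by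
  have hρ : (toMinimal E v * φ⁻¹) • W = toMinimal E v • E := by
    rw [← h, mul_smul, inv_smul_smul]
  have key := x_mem_iff_of_isMinimal v h2 h3 hW hb hΔ₀ hΔ'
    (E.exists_isMinimal v.ring).choose_spec _ hρ x
  rw [denom_eq_of_mapPoint E φ h Q hns hQ v]
  constructor
  · intro hx
    have hx := (v.ord_nonneg_iff _).2 (key.2 hx)
    rw [max_eq_right]
    · rfl
    · have : (0 : ℚ) ≤ (v.ord _ : ℚ) := Int.cast_nonneg hx
      linarith
  · intro hx
    have hx := (v.ord_neg_iff _).2 (mt key.1 hx)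
    rw [← WithTop.coe_zero, WithTop.coe_lt_coe]
    refine lt_max_of_lt_left ?_
    have : (v.ord _ : ℚ) < 0 := Int.cast_lt_zero.2 hx
    linarith

/-- By the ultrametric inequality e + a has the valuation of the unit a. Applied with a = 4 and a =
1 to invert c and 1 - c. -/
theorem inv_add_mem {A : ValuationSubring F} {a e : F} (ha : a ∈ A) (ha₀ : a ≠ 0) (ha' : a⁻¹ ∈ A)
    (he : e ∈ A.nonunits) : (e + a)⁻¹ ∈ A := by
  rw [← A.valuation_le_one_iff] at ha ha' ⊢
  rw [ValuationSubring.mem_nonunits_iff] at he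
  rw [map_inv₀] at ha' ⊢
  have h1 : A.valuation a = 1 :=
    le_antisymm ha ((inv_le_one₀ (zero_lt_iff.2 ((map_ne_zero _).2 ha₀))).1 ha')
  rw [Valuation.map_add_eq_of_lt_right _ (show A.valuation e < A.valuation a by rwa [h1]), h1,
    inv_one]

/-- At a place where `3c = 4`, the valuation is primitive in `D_{3P}` for `P = (c, c)` on
`y² = x³ + c² - c³`. -/
theorem isPrimitiveValuation_three [DecidableEq F] (h2 : (2 : K) ≠ 0) (h3 : (3 : K) ≠ 0)
    (E : WeierstrassCurve F) (P : E.toAffine.Point) {c : F} (hc₀ : c ≠ 0) (hc₁ : c ≠ 1)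
    (φ : VariableChange F)
    (h : φ • E = diagonalCurve c) (hns : (diagonalCurve c).toAffine.Nonsingular c c)
    (hP : mapPoint φ h P = .some c c hns) (v : Place K F) (hv : 3 * c - 4 ∈ v.ring.nonunits)
    (hv₀ : 3 * c - 4 ≠ 0) : IsPrimitiveValuation E P 3 v := by
  have hK : ∀ k : K, algebraMap K F k ∈ v.ring := v.algebraMap_mem
  have h2F : (2 : F) ≠ 0 := by simpa only [map_ofNat] using (map_ne_zero (algebraMap K F)).2 h2
  have h3F : (3 : F) ≠ 0 := by simpa only [map_ofNat] using (map_ne_zero (algebraMap K F)).2 h3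
  have h4F : (4 : F) ≠ 0 := by
    rw [show (4 : F) = 2 * 2 by norm_num]
    simp [h2F]
  have hnat : ∀ n : ℕ, (n : F) ∈ v.ring := fun n => natCast_mem _ n
  have hinv : ∀ n : ℕ, (n : F)⁻¹ ∈ v.ring := fun n => by
    have := hK (n : K)⁻¹
    rwa [map_inv₀, map_natCast] at this
  obtain ⟨e, he⟩ : ∃ e, e = 3 * c - 4 := ⟨_, rfl⟩
  rw [← he] at hv hv₀
  have hce : c = 3⁻¹ * (e + 4) := by
    rw [he]
    field_simp
    ring
  have he_mem : e ∈ v.ring := v.ring.nonunits_subset hv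
  have hc_mem : c ∈ v.ring := by
    rw [hce]
    exact mul_mem (hinv 3) (add_mem he_mem (hnat 4))
  have hc_inv : c⁻¹ ∈ v.ring := by
    rw [hce, mul_inv, inv_inv]
    exact mul_mem (hnat 3) (inv_add_mem (hnat 4) h4F (hinv 4) hv)
  have hc_inv' : (1 - c)⁻¹ ∈ v.ring := by
    have : 1 - c = -(3⁻¹ * (e + 1)) := by
      rw [hce]
      field_simp
      ring
    rw [this, inv_neg, mul_inv, inv_inv]
    exact neg_mem (mul_mem (hnat 3) (inv_add_mem (one_mem _) one_ne_zero (by simp) hv))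
  have hW : WeierstrassCurve.IsIntegral v.ring (diagonalCurve c) := by
    refine ⟨diagonalCurve ⟨c, hc_mem⟩, ?_⟩
    simp only [diagonalCurve, WeierstrassCurve.baseChange, WeierstrassCurve.map, map_zero, map_sub,
      map_pow]
    rfl
  have hb : (diagonalCurve c).b₂ = 0 := by simp [WeierstrassCurve.b₂, diagonalCurve]
  have hΔ : (diagonalCurve c).Δ = -(432 * c ^ 4 * (1 - c) ^ 2) := by
    rw [diagonalCurve_Δ]
    ring
  have hΔ₀ : (diagonalCurve c).Δ ≠ 0 := by
    rw [hΔ, show (432 : F) = 2 * 2 * 2 * 2 * (3 * 3 * 3) by norm_num]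
    simp [h2F, h3F, hc₀, sub_eq_zero, hc₁.symm]
  have hΔ' : (diagonalCurve c).Δ⁻¹ ∈ v.ring := by
    rw [hΔ, inv_neg, mul_inv, mul_inv, ← inv_pow, ← inv_pow]
    exact neg_mem (mul_mem (mul_mem (hinv 432) (pow_mem hc_inv 4)) (pow_mem hc_inv' 2))
  have key := fun (Q : E.toAffine.Point) {x y : F} hns hQ =>
    denom_of_mapPoint (x := x) (y := y) h2 h3 E φ h Q hns hQ v hW hb hΔ₀ hΔ'
  refine ⟨?_, fun m hm₁ hm₃ => ?_⟩
  · obtain ⟨y, h', e₃⟩ := three_nsmul_some hns h2F h3F hc₀ (he ▸ hv₀)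
    rw [← hP, ← mapPoint_nsmul] at e₃
    refine (key _ _ e₃).2 fun hmem => ?_
    rw [← he] at hmem
    have h9 : (9 : F) ≠ 0 := by
      rw [show (9 : F) = 3 * 3 by norm_num]
      simp [h3F]
    generalize hX : c + 64 / (9 * e ^ 2) + 8 * c / e = X at hmem
    -- The formula for x(3P) times 9e². If X were integral, e would divide the unit 64.
    have hXe : e * (9 * (e * (X - c) - 8 * c)) = 64 := by
      rw [← hX]
      field_simp
      ring
    have hmem' : 9 * (e * (X - c) - 8 * c) ∈ v.ring :=
      mul_mem (hnat 9) (sub_mem (mul_mem he_mem (sub_mem hmem hc_mem)) (mul_mem (hnat 8) hc_mem))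
    have h64 : e⁻¹ ∈ v.ring := by
      have h64₀ : (64 : F) ≠ 0 := by
        rw [show (64 : F) = 2 * 2 * 2 * 2 * 2 * 2 by norm_num]
        simp [h2F]
      have : e⁻¹ = (64 : F)⁻¹ * (9 * (e * (X - c) - 8 * c)) := by
        rw [inv_eq_iff_eq_inv, ← div_eq_inv_mul, inv_div, eq_div_iff, hXe]
        intro h0
        rw [h0, mul_zero] at hXe
        exact h64₀ hXe.symm
      rw [this]
      exact mul_mem (hinv 64) hmem'
    rcases (ValuationSubring.mem_nonunits_iff_or _).1 hv with h0 | h0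
    · exact hv₀ h0
    · exact h0 h64
  · obtain rfl | rfl : m = 1 ∨ m = 2 := by omega
    · rw [one_nsmul]
      exact (key _ _ hP).1 hc_mem
    · obtain ⟨h', e₂⟩ := two_nsmul_some hns h2F hc₀
      rw [← hP, ← mapPoint_nsmul] at e₂
      refine (key _ _ e₂).1 ?_
      exact sub_mem (mul_mem (by rw [div_eq_mul_inv]; exact mul_mem (hnat 9) (hinv 4))
        (pow_mem hc_mem 2)) (mul_mem (hnat 2) hc_mem)

/-- If `c` is a constant, then `(c, c)` on `y² = x³ + c² - c³` is constant. -/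
theorem isConstantPair_of_diagonalCurve (h2 : (2 : K) ≠ 0) (h3 : (3 : K) ≠ 0)
    (E : WeierstrassCurve F) (P : E.toAffine.Point) {c : K} (hc₀ : c ≠ 0) (hc₁ : c ≠ 1)
    (φ : VariableChange F) (h : φ • E = diagonalCurve (algebraMap K F c))
    (hns : (diagonalCurve (algebraMap K F c)).toAffine.Nonsingular
      (algebraMap K F c) (algebraMap K F c))
    (hP : mapPoint φ h P = .some _ _ hns) : IsConstantPair K E P := by
  have hbc : diagonalCurve (algebraMap K F c) = (diagonalCurve c).baseChange F := by
    simp [diagonalCurve, WeierstrassCurve.baseChange, WeierstrassCurve.map]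
  have hE : (diagonalCurve c).IsElliptic := by
    rw [isElliptic_iff, diagonalCurve_Δ, isUnit_iff_ne_zero,
      show (-432 : K) = -(2 * 2 * 2 * 2 * (3 * 3 * 3)) by norm_num,
      show c ^ 2 - c ^ 3 = c ^ 2 * (1 - c) by ring]
    simp [h2, h3, hc₀, sub_eq_zero, hc₁.symm]
  refine ⟨diagonalCurve c, hE, φ, h.trans hbc, ?_⟩
  have hnsK : (diagonalCurve c).toAffine.Nonsingular c c := by
    rw [← Affine.equation_iff_nonsingular, Affine.equation_iff]
    simp [diagonalCurve]
  refine ⟨.some c c hnsK, ?_⟩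
  -- The two curves over F are only propositionally equal; after eliminating the equation the points
  -- agree definitionally.
  generalize diagonalCurve (algebraMap K F c) = W at *
  subst hbc
  rw [hP]
  rfl

end Reduction

end EllDiv

namespace EllDiv

/-! ### Discrete valuation rings and zeros of transcendental functions -/

section Places

open Polynomial

/-- A nontrivial valuation ring of the fraction field of a Dedekind domain which contains the
Dedekind domain is discrete. -/
theorem isDiscreteValuationRing_of_dedekind {F : Type v} [Field F] (D : Type*) [CommRing D]
    [IsDedekindDomain D] [Algebra D F] [IsFractionRing D F] (V : ValuationSubring F)
    (hD : ∀ d : D, algebraMap D F d ∈ V) {s : F} (hs : s ∈ V.nonunits) (hs₀ : s ≠ 0) :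
    IsDiscreteValuationRing V := by
  let i : D →+* V := (algebraMap D F).codRestrict V.toSubring hD
  let _ : Algebra D V := i.toAlgebra
  let 𝔭 : Ideal D := (IsLocalRing.maximalIdeal V).comap i
  have h𝔭 : 𝔭.IsPrime := Ideal.comap_isPrime _ _
  have hmem : ∀ d : D, d ∈ 𝔭 ↔ algebraMap D F d ∈ V.nonunits := fun d => by
    rw [show algebraMap D F d = (i d : F) from rfl, ValuationSubring.coe_mem_nonunits_iff]
    rfl
  -- If the centre 𝔭 of V were zero, V would contain all fractions, including s⁻¹.
  have hne : 𝔭 ≠ ⊥ := by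
    intro h
    obtain ⟨a, b, hb, hab⟩ := IsFractionRing.div_surjective (A := D) s⁻¹
    have hb₀ : b ≠ 0 := nonZeroDivisors.ne_zero hb
    have hbV : (algebraMap D F b)⁻¹ ∈ V := by
      by_contra hbV
      have : b ∈ 𝔭 := (hmem b).2 ((V.mem_nonunits_iff_or).2 (Or.inr hbV))
      rw [h, Ideal.mem_bot] at this
      exact hb₀ this
    have : s⁻¹ ∈ V := by
      rw [← hab, div_eq_mul_inv]
      exact mul_mem (hD a) hbV
    exact ((V.mem_nonunits_iff_or).1 hs).elim hs₀ (· this)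
  have hdvr := IsLocalization.AtPrime.isDiscreteValuationRing_of_dedekind_domain D hne
    (Localization.AtPrime 𝔭)
  let _ : Algebra (Localization.AtPrime 𝔭) F := (IsLocalization.lift (M := 𝔭.primeCompl)
    (S := Localization.AtPrime 𝔭) (g := algebraMap D F) (by
      intro y
      rw [isUnit_iff_ne_zero, map_ne_zero_iff _ (IsFractionRing.injective D F)]
      intro h
      exact y.2 (h ▸ 𝔭.zero_mem))).toAlgebra
  have : IsScalarTower D (Localization.AtPrime 𝔭) F := .of_algebraMap_eq fun x =>
    (IsLocalization.lift_eq _ _).symm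
  have : IsFractionRing (Localization.AtPrime 𝔭) F :=
    IsFractionRing.isFractionRing_of_isDomain_of_isLocalization 𝔭.primeCompl _ _
  have hval : ∀ r : Localization.AtPrime 𝔭, ∃ a b : D, b ∉ 𝔭 ∧
      algebraMap _ F r * algebraMap D F b = algebraMap D F a := by
    intro r
    obtain ⟨⟨a, b⟩, h⟩ := IsLocalization.surj 𝔭.primeCompl r
    refine ⟨a, b, b.2, ?_⟩
    have := congrArg (algebraMap (Localization.AtPrime 𝔭) F) h
    rwa [map_mul, ← IsScalarTower.algebraMap_apply, ← IsScalarTower.algebraMap_apply] at this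
  have hloc : IsLocalization.AtPrime V 𝔭 := by
    refine ⟨fun y => ?_, fun z => ?_, fun {x y} h => ⟨1, ?_⟩⟩
    · by_contra h
      exact y.2 h
    -- The localization at 𝔭 is a valuation ring of F, so it contains z or z⁻¹. If z⁻¹ = a/b with b
    -- ∉ 𝔭, then b = za forces a ∉ 𝔭, so z = b/a is again in the localization.
    · have key : ∃ a b : D, b ∉ 𝔭 ∧ (z : F) * algebraMap D F b = algebraMap D F a := by
        rcases ValuationRing.isInteger_or_isInteger (Localization.AtPrime 𝔭) (z : F) with h | h
        · obtain ⟨r, hr⟩ := h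
          rw [← hr]
          exact hval r
        · obtain ⟨r, hr⟩ := h
          by_cases hz : (z : F) = 0
          · exact ⟨0, 1, (Ideal.ne_top_iff_one _).1 h𝔭.ne_top, by simp [hz]⟩
          obtain ⟨a, b, hb, hab⟩ := hval r
          rw [hr] at hab
          have hab' : algebraMap D F b = z * algebraMap D F a := by
            rw [← hab, mul_inv_cancel_left₀ hz]
          refine ⟨b, a, fun ha => hb ?_, hab'.symm⟩
          have : i b = z * i a := Subtype.ext hab'
          change i b ∈ IsLocalRing.maximalIdeal V
          rw [this]
          exact Ideal.mul_mem_left _ _ ha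
      obtain ⟨a, b, hb, h⟩ := key
      exact ⟨⟨a, ⟨b, hb⟩⟩, Subtype.ext h⟩
    · have : algebraMap D F x = algebraMap D F y := congrArg Subtype.val h
      rw [IsFractionRing.injective D F this]
  exact IsLocalization.AtPrime.isDiscreteValuationRing_of_dedekind_domain D hne V

variable {K : Type u} [Field K] {F : Type v} [Field F] [Algebra K F]

/-- If `Ω[F⁄K]` is generated by `dx`, then `F` is unramified over `K[x]`. -/
theorem formallyUnramified_of_span_D (x : F)
    (hx : ∀ ω : Ω[F⁄K], ∃ a : F, a • KaehlerDifferential.D K F x = ω) [Algebra K[X] F]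
    [IsScalarTower K K[X] F] (hX : algebraMap K[X] F X = x) :
    Algebra.FormallyUnramified K[X] F := by
  refine ⟨subsingleton_of_forall_eq 0 fun ω => ?_⟩
  obtain ⟨ω, rfl⟩ := KaehlerDifferential.map_surjective K K[X] F ω
  obtain ⟨a, rfl⟩ := hx ω
  rw [map_smul, KaehlerDifferential.map_D, Algebra.algebraMap_self, RingHom.id_apply, ← hX,
    Derivation.map_algebraMap, smul_zero]

/-- If `x` generates `Ω[F⁄K]` and is transcendental, then any nontrivial valuation ring containing
`K` and `x` is discrete. -/
theorem isDiscreteValuationRing_of_span_D [Algebra.EssFiniteType K F] (x : F)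
    (hx : ∀ ω : Ω[F⁄K], ∃ a : F, a • KaehlerDifferential.D K F x = ω)
    (V : ValuationSubring F) (hK : ∀ k : K, algebraMap K F k ∈ V) (hxV : x ∈ V)
    {s : F} (hs : s ∈ V.nonunits) (hs₀ : s ≠ 0) (hst : Transcendental K s) :
    IsDiscreteValuationRing V := by
  let _ : Algebra K[X] F := (aeval x).toAlgebra
  have : IsScalarTower K K[X] F := .of_algebraMap_eq fun k => (aeval_C x k).symm
  have hunr := formallyUnramified_of_span_D x hx (aeval_X x)
  have hess : Algebra.EssFiniteType K[X] F := .of_comp K _ _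
  -- Otherwise F, unramified and essentially of finite type over the finite extension K(x), would be
  -- finite over K, against the transcendence of s.
  have hxt : Transcendental K x := by
    intro hxa
    let L := IntermediateField.adjoin K {x}
    have : FiniteDimensional K L := IntermediateField.adjoin.finiteDimensional hxa.isIntegral
    let _ : Algebra K[X] L := (aeval (IntermediateField.AdjoinSimple.gen K x)).toAlgebra
    have : IsScalarTower K[X] L F := .of_algebraMap_eq fun p => by
      change aeval x p = algebraMap L F (aeval _ p)
      rw [← aeval_algebraMap_apply, IntermediateField.AdjoinSimple.algebraMap_gen]
    have : Algebra.FormallyUnramified L F := .of_restrictScalars K[X] _ _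
    have : Algebra.EssFiniteType L F := .of_comp K _ _
    have : FiniteDimensional L F := Algebra.FormallyUnramified.finite_of_free _ _
    have : FiniteDimensional K F := Module.Finite.trans L F
    exact hst (Algebra.IsAlgebraic.isAlgebraic s)
  have hinj : Function.Injective (algebraMap K[X] F) := transcendental_iff_injective.1 hxt
  have : FaithfulSMul K[X] F := (faithfulSMul_iff_algebraMap_injective _ _).2 hinj
  let _ : Algebra (FractionRing K[X]) F := FractionRing.liftAlgebra K[X] F
  have : Algebra.FormallyUnramified (FractionRing K[X]) F := .of_restrictScalars K[X] _ _
  have : Algebra.EssFiniteType (FractionRing K[X]) F := .of_comp K[X] _ _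
  have : FiniteDimensional (FractionRing K[X]) F :=
    Algebra.FormallyUnramified.finite_of_free _ _
  have : Algebra.IsSeparable (FractionRing K[X]) F :=
    Algebra.FormallyUnramified.isSeparable _ _
  have : IsFractionRing (integralClosure K[X] F) F :=
    IsIntegralClosure.isFractionRing_of_finite_extension K[X] (FractionRing K[X]) F _
  refine isDiscreteValuationRing_of_dedekind (integralClosure K[X] F) V ?_ hs hs₀
  rintro ⟨d, p, hp, hd⟩
  change d ∈ V
  have hpV : ∀ q : K[X], algebraMap K[X] F q ∈ V := fun q => by
    change aeval x q ∈ V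
    rw [aeval_eq_sum_range]
    refine sum_mem fun n _ => ?_
    rw [Algebra.smul_def]
    exact mul_mem (hK _) (pow_mem hxV n)
  let i : K[X] →+* V := (algebraMap K[X] F).codRestrict V.toSubring hpV
  have hint : IsIntegral V d := ⟨p.map i, hp.map i, by rw [eval₂_map]; exact hd⟩
  obtain ⟨y, hy⟩ := IsIntegrallyClosed.isIntegral_iff.1 hint
  exact hy ▸ y.2

/-- Every transcendental function has a zero. -/
theorem Place.exists_mem_nonunits [Algebra.EssFiniteType K F]
    (hΩ : Module.finrank F Ω[F⁄K] = 1) {s : F} (hs : Transcendental K s) :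
    ∃ v : Place K F, s ∈ v.ring.nonunits := by
  let A := Algebra.adjoin K {s}
  have hsA : s ∈ A := Algebra.self_mem_adjoin_singleton K s
  let I : Ideal A.toSubring := Ideal.span {⟨s, hsA⟩}
  have hI : I ≠ ⊤ := by
    intro h
    obtain ⟨⟨a, ha⟩, has⟩ := Ideal.mem_span_singleton'.1 ((Ideal.eq_top_iff_one _).1 h)
    obtain ⟨p, rfl⟩ := (Algebra.adjoin_mem_exists_aeval K s ha)
    have h1 : aeval s p * s = 1 := congrArg Subtype.val has
    have h2 : p * X - 1 = 0 := by
      by_contra h0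
      exact hs ⟨_, h0, by simp [h1]⟩
    simpa using congrArg (eval 0) h2
  obtain ⟨V, hAV, hIV⟩ := Ideal.image_subset_nonunits_valuationSubring I hI
  have hK : ∀ k : K, algebraMap K F k ∈ V := fun k => hAV (A.algebraMap_mem k)
  have hsV : s ∈ V.nonunits := hIV ⟨⟨s, hsA⟩, Ideal.subset_span rfl, rfl⟩
  have hs₀ : s ≠ 0 := by
    rintro rfl
    exact hs (isAlgebraic_zero)
  -- In characteristic p the differential of s may vanish, so separability is obtained from another
  -- function x.
  obtain ⟨x, hx⟩ : ∃ x : F, KaehlerDifferential.D K F x ≠ 0 := by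
    by_contra! h
    have htop := KaehlerDifferential.span_range_derivation K F
    rw [show Set.range (KaehlerDifferential.D K F) = {0} from by
      ext; simp [h, eq_comm], Submodule.span_zero_singleton] at htop
    have : Subsingleton Ω[F⁄K] := (Submodule.subsingleton_iff F).1 (subsingleton_of_bot_eq_top htop)
    rw [Module.finrank_zero_of_subsingleton] at hΩ
    exact zero_ne_one hΩ
  have hx' := (finrank_eq_one_iff_of_nonzero' _ hx).1 hΩ
  have hx₀ : x ≠ 0 := by
    rintro rfl
    exact hx (map_zero _)
  refine ⟨⟨V, hK, ?_⟩, hsV⟩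
  rcases V.mem_or_inv_mem x with hxV | hxV
  · exact isDiscreteValuationRing_of_span_D x hx' V hK hxV hsV hs₀ hs
  · refine isDiscreteValuationRing_of_span_D x⁻¹ (fun ω => ?_) V hK hxV hsV hs₀ hs
    obtain ⟨a, rfl⟩ := hx' ω
    -- From d(x⁻¹) = -x⁻² dx.
    refine ⟨a * -x ^ 2, ?_⟩
    rw [Derivation.leibniz_inv, smul_smul]
    congr 1
    field_simp

end Places

/-! ### Smooth algebras over a field -/

section Smooth

open Polynomial TensorProduct

/-- Smooth algebras over a field are reduced. -/
theorem isReduced_of_smooth (k : Type*) [Field k] (S : Type*) [CommRing S] [Algebra k S]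
    [Algebra.Smooth k S] : IsReduced S := by
  refine ⟨fun z hz => ?_⟩
  -- Being nilpotent, z ⊗ X is integral over S. Smooth base change commutes with integral closure,
  -- and elements of k[X] integral over k are constants, so the coefficient z of X must vanish.
  have hw : IsNilpotent (z ⊗ₜ[k] (X : k[X])) := by
    obtain ⟨n, hn⟩ := hz
    exact ⟨n, by rw [Algebra.TensorProduct.tmul_pow, hn, zero_tmul]⟩
  obtain ⟨y, hy⟩ := (TensorProduct.toIntegralClosure_bijective_of_smooth (R := k) (S := S)
    (B := k[X])).2 ⟨_, (show IsIntegral S (z ⊗ₜ[k] (X : k[X])) from by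
      obtain ⟨n, hn⟩ := hw
      exact ⟨X ^ n, monic_X_pow n, by rw [eval₂_X_pow, hn]⟩)⟩
  have hy' : Algebra.TensorProduct.map (AlgHom.id S S) (integralClosure k k[X]).val y =
      z ⊗ₜ[k] (X : k[X]) := congrArg Subtype.val hy
  have hzero : (lcoeff k 1) ∘ₗ (integralClosure k k[X]).val.toLinearMap = 0 := by
    ext ⟨q, hq⟩
    change q.coeff 1 = 0
    refine coeff_eq_zero_of_natDegree_lt ?_
    by_contra hdeg
    refine Polynomial.transcendental q (by omega) ?_ hq.isAlgebraic
    have hq0 : q ≠ 0 := by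
      rintro rfl
      simp at hdeg
    exact mem_nonZeroDivisors_of_ne_zero (leadingCoeff_ne_zero.2 hq0)
  have h₁ : LinearMap.lTensor S (lcoeff k 1)
      (LinearMap.lTensor S (integralClosure k k[X]).val.toLinearMap y) = 0 := by
    rw [← LinearMap.comp_apply, ← LinearMap.lTensor_comp, hzero, LinearMap.lTensor_zero,
      LinearMap.zero_apply]
  have h₂ : LinearMap.lTensor S (integralClosure k k[X]).val.toLinearMap y = z ⊗ₜ[k] (X : k[X]) :=
    hy'
  rw [h₂, LinearMap.lTensor_tmul, lcoeff_apply, coeff_X_one] at h₁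
  simpa using congrArg (TensorProduct.rid k S) h₁

/-- An element of a geometrically integral algebra which is algebraic over the base field lies in
the base field. -/
theorem mem_range_of_isDomain_tensorProduct (k : Type*) [Field k] (A : Type*) [CommRing A]
    [Algebra k A] [IsDomain (AlgebraicClosure k ⊗[k] A)] {t : A} (ht : IsAlgebraic k t) :
    t ∈ (algebraMap k A).range := by
  by_contra hmem
  have hnt : Nontrivial A := by
    by_contra h
    rw [not_nontrivial_iff_subsingleton] at h
    exact hmem ⟨0, Subsingleton.elim _ _⟩
  obtain ⟨q, hq₀, hq⟩ := ht
  let Ω := AlgebraicClosure k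
  have hs := IsAlgClosed.splits (q.map (algebraMap k Ω))
  have heval : aeval ((1 : Ω) ⊗ₜ[k] t) (q.map (algebraMap k Ω)) = 0 := by
    rw [aeval_map_algebraMap]
    have : (1 : Ω) ⊗ₜ[k] t = Algebra.TensorProduct.includeRight (R := k) (A := Ω) t := rfl
    rw [this, aeval_algHom_apply, hq, map_zero]
  rw [hs.eq_prod_roots] at heval
  -- In a domain, a root of a split polynomial is one of the listed roots.
  obtain ⟨a, ha⟩ : ∃ a : Ω, (1 : Ω) ⊗ₜ[k] t = a ⊗ₜ[k] (1 : A) := by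
    rw [map_mul, mul_eq_zero, aeval_C] at heval
    rcases heval with h | h
    · rw [map_eq_zero_iff _ (FaithfulSMul.algebraMap_injective Ω (Ω ⊗[k] A)),
        leadingCoeff_eq_zero, Polynomial.map_eq_zero] at h
      exact absurd h hq₀
    · rw [map_multiset_prod, Multiset.prod_eq_zero_iff, Multiset.map_map, Multiset.mem_map] at h
      obtain ⟨a, -, ha⟩ := h
      refine ⟨a, ?_⟩
      rw [Function.comp_apply, map_sub, aeval_X, aeval_C, sub_eq_zero] at ha
      exact ha
  -- A functional that kills 1 but not t contradicts 1 ⊗ t = a ⊗ 1.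
  obtain ⟨g, hg, hg'⟩ := Submodule.exists_le_ker_of_notMem
    (p := Submodule.span k {(1 : A)}) (v := t) (by
      rw [Submodule.mem_span_singleton]
      rintro ⟨b, hb⟩
      exact hmem ⟨b, by rw [Algebra.algebraMap_eq_smul_one, hb]⟩)
  have h1 : g 1 = 0 := hg' (Submodule.mem_span_singleton_self 1)
  have h := congrArg (fun w => TensorProduct.rid k Ω (LinearMap.lTensor Ω g w)) ha
  simp only [LinearMap.lTensor_tmul, h1, TensorProduct.rid_tmul, zero_smul] at h
  exact hg ((smul_eq_zero.1 h).resolve_right one_ne_zero)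

/-- The geometric points of a smooth geometrically irreducible affine scheme form a domain. -/
theorem isDomain_tensorProduct_of_smooth (k : Type u) [Field k] (A : Type u) [CommRing A]
    [Algebra k A] [Algebra.Smooth k A]
    [GeometricallyIrreducible (Spec.map (CommRingCat.ofHom (algebraMap k A)))] :
    IsDomain (AlgebraicClosure k ⊗[k] A) := by
  have hred : IsReduced (AlgebraicClosure k ⊗[k] A) :=
    isReduced_of_smooth (AlgebraicClosure k) _
  have hirr : IrreducibleSpace ↥(Limits.pullback
      (Spec.map (CommRingCat.ofHom (algebraMap k (AlgebraicClosure k))))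
      (Spec.map (CommRingCat.ofHom (algebraMap k A)))) :=
    pullback_of_geometrically' GeometricallyIrreducible.geometrically_irreducibleSpace _ _
  have : IrreducibleSpace (Spec (CommRingCat.of (AlgebraicClosure k ⊗[k] A))) :=
    (pullbackSpecIso k (AlgebraicClosure k) A).hom.homeomorph.irreducibleSpace_iff.1 hirr
  have h := PrimeSpectrum.irreducibleSpace_iff_isPrime_nilradical.1 this
  rw [nilradical_eq_zero, Ideal.zero_eq_bot] at h
  exact IsDomain.of_bot_isPrime _

/-- The function field of a standard smooth domain of relative dimension one is finitely generated
with a one-dimensional space of differentials. -/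
theorem finrank_kaehlerDifferential_eq_one (k : Type u) [Field k] (A : Type u) [CommRing A]
    [IsDomain A] [Algebra k A] [Algebra.IsStandardSmoothOfRelativeDimension 1 k A]
    (F : Type v) [Field F] [Algebra k F] [Algebra A F] [IsScalarTower k A F] [IsFractionRing A F] :
    Algebra.EssFiniteType k F ∧ Module.finrank F Ω[F⁄k] = 1 := by
  have hA : Algebra.IsStandardSmooth k A :=
    Algebra.IsStandardSmoothOfRelativeDimension.isStandardSmooth 1
  constructor
  · have : Algebra.EssFiniteType A F := .of_isLocalization _ (nonZeroDivisors A)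
    exact .comp k A F
  · have : Algebra.FormallyEtale A F := .of_isLocalization (nonZeroDivisors A)
    have h := Algebra.IsStandardSmoothOfRelativeDimension.rank_kaehlerDifferential (R := k) (S := A) 1
    have h' : Module.finrank A Ω[A⁄k] = 1 := Module.finrank_eq_of_rank_eq h
    rw [← (KaehlerDifferential.tensorKaehlerEquivOfFormallyEtale k A F).finrank_eq,
      Module.finrank_baseChange, h']

end Smooth

/-! ### Differentials and constants of the function field -/

section FunctionField

variable {K : Type u} [Field K]

/-- The inclusion of the constants in the sections of a `K`-scheme over an open subset. -/
noncomputable def constantsOn {C : Scheme.{u}} (f : C ⟶ Spec (CommRingCat.of K)) (V : C.Opens) :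
    CommRingCat.of K ⟶ Γ(C, V) :=
  (Scheme.ΓSpecIso (CommRingCat.of K)).inv ≫ f.appLE ⊤ V le_top

theorem germToFunctionField_constantsOn {C : Scheme.{u}} [IsIntegral C]
    (f : C ⟶ Spec (CommRingCat.of K)) (V : C.Opens) [Nonempty V] (c : K) :
    C.germToFunctionField V (constantsOn f V c) = constants f c := by
  exact C.presheaf.germ_res_apply (homOfLE le_top) (genericPoint C) _
    (f.appTop ((Scheme.ΓSpecIso (CommRingCat.of K)).inv c))

theorem smooth_constantsOn {C : Scheme.{u}} (f : C ⟶ Spec (CommRingCat.of K)) [Smooth f]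
    {V : C.Opens} (hV : IsAffineOpen V) : (constantsOn f V).hom.Smooth := by
  have h := f.smooth_appLE (isAffineOpen_top _) hV le_top
  exact RingHom.Smooth.respectsIso.2 _ (Scheme.ΓSpecIso (CommRingCat.of K)).symm.commRingCatIsoToRingEquiv h

theorem geometricallyIrreducible_constantsOn {C : Scheme.{u}} (f : C ⟶ Spec (CommRingCat.of K))
    [GeometricallyIrreducible f] {V : C.Opens} (hV : IsAffineOpen V) [Nonempty V] :
    GeometricallyIrreducible (Spec.map (constantsOn f V)) := by
  have h : Spec.map (constantsOn f V) = hV.fromSpec ≫ f := by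
    rw [constantsOn, Spec.map_comp, ← IsAffineOpen.SpecMap_appLE_fromSpec f (isAffineOpen_top _) hV le_top,
      IsAffineOpen.fromSpec_top, Scheme.isoSpec_Spec_inv]
  rw [h]
  -- Nonemptiness of V enters here: Spec K is a single point.
  have : Surjective (hV.fromSpec ≫ f) := by
    obtain ⟨x, hx⟩ := ‹Nonempty V›
    rw [← SetLike.mem_coe, ← hV.range_fromSpec] at hx
    obtain ⟨y, -⟩ := hx
    exact ⟨fun _ => ⟨y, Subsingleton.elim (α := PrimeSpectrum K) _ _⟩⟩
  infer_instance

theorem exists_isStandardSmooth_constantsOn {C : Scheme.{u}} [Nonempty C]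
    (f : C ⟶ Spec (CommRingCat.of K)) [SmoothOfRelativeDimension 1 f] :
    ∃ V : C.Opens, IsAffineOpen V ∧ Nonempty V ∧
      (constantsOn f V).hom.IsStandardSmoothOfRelativeDimension 1 := by
  obtain ⟨x⟩ := ‹Nonempty C›
  obtain ⟨U, hU, V, hV, hx, e, h⟩ :=
    SmoothOfRelativeDimension.exists_isStandardSmoothOfRelativeDimension (n := 1) (f := f) x
  obtain rfl : U = ⊤ := by
    refine eq_top_iff.2 fun y _ => ?_
    rw [Subsingleton.elim (α := PrimeSpectrum K) y (f x)]
    exact e hx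
  refine ⟨V, hV, ⟨x, hx⟩, ?_⟩
  exact (RingHom.isStandardSmoothOfRelativeDimension_respectsIso (n := 1)).2 _
    (Scheme.ΓSpecIso (CommRingCat.of K)).symm.commRingCatIsoToRingEquiv h

variable {F : Type v} [Field F] [Algebra K F]

theorem IsFunctionFieldOfCurve.finrank_kaehlerDifferential (hF : IsFunctionFieldOfCurve K F) :
    Algebra.EssFiniteType K F ∧ Module.finrank F Ω[F⁄K] = 1 := by
  obtain ⟨C, f, _, -, hsm, -, e, he⟩ := hF
  obtain ⟨V, hV, _, h⟩ := exists_isStandardSmooth_constantsOn f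
  let _ : Algebra K Γ(C, V) := (constantsOn f V).hom.toAlgebra
  let _ : Algebra Γ(C, V) F := (e.symm.toRingHom.comp (C.germToFunctionField V).hom).toAlgebra
  have : IsScalarTower K Γ(C, V) F := .of_algebraMap_eq fun c => by
    change _ = e.symm (C.germToFunctionField V (constantsOn f V c))
    rw [germToFunctionField_constantsOn, ← he, e.symm_apply_apply]
  have := functionField_isFractionRing_of_isAffineOpen C V hV
  have : IsFractionRing Γ(C, V) F :=
    IsLocalization.isLocalization_of_algEquiv (nonZeroDivisors Γ(C, V))
      ({ e.symm with commutes' := fun _ => rfl } : C.functionField ≃ₐ[Γ(C, V)] F)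
  have : Algebra.IsStandardSmoothOfRelativeDimension 1 K Γ(C, V) := h
  exact finrank_kaehlerDifferential_eq_one K Γ(C, V) F

/-- The field of constants of the function field of a smooth geometrically irreducible curve is
algebraically closed in it. -/
theorem IsFunctionFieldOfCurve.mem_range_of_isAlgebraic (hF : IsFunctionFieldOfCurve K F) {t : F}
    (ht : IsAlgebraic K t) : t ∈ (algebraMap K F).range := by
  obtain ⟨C, f, _, -, hsm, hirr, e, he⟩ := hF
  have hsm' : Smooth f := hsm.smooth
  by_cases ht₀ : t = 0
  · exact ⟨0, by rw [ht₀, map_zero]⟩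
  -- V is an affine open on which t is a regular function; the case t = 0 was split off because the
  -- germ is required to be a unit.
  obtain ⟨V, hV, t', _, ht', -⟩ := exists_isUnit_germ_eq C (e t) (by simpa using ht₀)
  let _ : Algebra K Γ(C, V) := (constantsOn f V).hom.toAlgebra
  have : Algebra.Smooth K Γ(C, V) := smooth_constantsOn f hV
  have : GeometricallyIrreducible (Spec.map (CommRingCat.ofHom (algebraMap K Γ(C, V)))) :=
    geometricallyIrreducible_constantsOn f hV
  let i : Γ(C, V) →+* F := e.symm.toRingHom.comp (C.germToFunctionField V).hom
  have hi : Function.Injective i := e.symm.injective.comp (C.germToFunctionField_injective V)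
  have hit : i t' = t := by
    change e.symm (C.germToFunctionField V t') = t
    rw [ht', e.symm_apply_apply]
  have hic : ∀ c : K, i (algebraMap K Γ(C, V) c) = algebraMap K F c := fun c => by
    change e.symm (C.germToFunctionField V (constantsOn f V c)) = _
    rw [germToFunctionField_constantsOn, ← he, e.symm_apply_apply]
  let iK : Γ(C, V) →ₐ[K] F := { i with commutes' := hic }
  have halg : IsAlgebraic K t' := (isAlgebraic_algHom_iff iK hi).1 (by
    change IsAlgebraic K (i t')
    rwa [hit])
  have := isDomain_tensorProduct_of_smooth K Γ(C, V)
  obtain ⟨c, hc⟩ := mem_range_of_isDomain_tensorProduct K Γ(C, V) halg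
  exact ⟨c, by rw [← hic, hc, hit]⟩

end FunctionField

end EllDiv

theorem mainTheorem7 {K : Type u} [Field K] (p : ℕ) [CharP K p] (hp2 : p ≠ 2) (hp3 : p ≠ 3)
    {F : Type v} [Field F] [DecidableEq F] [Algebra K F]
    (hF : EllDiv.IsFunctionFieldOfCurve K F)
    (E : WeierstrassCurve F) [E.IsElliptic] (hj : E.j = 0)
    (P : E.toAffine.Point) (hP : ¬ IsOfFinAddOrder P)
    (hEP : ¬ EllDiv.IsConstantPair K E P) :
    ∃ v : EllDiv.Place K F, EllDiv.IsPrimitiveValuation E P 3 v := by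
  have hprime : ∀ q : ℕ, q.Prime → p ≠ q → (q : K) ≠ 0 := fun q hq hpq h => by
    have hdvd := (CharP.cast_eq_zero_iff K p q).1 h
    rcases (Nat.dvd_prime hq).1 hdvd with h1 | h1
    · exact CharP.char_ne_one K p h1
    · exact hpq h1
  have h2 : (2 : K) ≠ 0 := by simpa only [Nat.cast_ofNat] using hprime 2 Nat.prime_two hp2
  have h3 : (3 : K) ≠ 0 := by simpa only [Nat.cast_ofNat] using hprime 3 Nat.prime_three hp3
  have h2F : (2 : F) ≠ 0 := by simpa only [map_ofNat] using (map_ne_zero (algebraMap K F)).2 h2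
  have h3F : (3 : F) ≠ 0 := by simpa only [map_ofNat] using (map_ne_zero (algebraMap K F)).2 h3
  obtain ⟨c, φ, hφ, hns, hc₀, hc₁, hc⟩ := EllDiv.exists_diagonalCurve h2F h3F E hj P hP
  have hs : Transcendental K (3 * c - 4) := by
    intro halg
    obtain ⟨a, ha⟩ := hF.mem_range_of_isAlgebraic halg
    -- Solving 3c - 4 = a shows that c is a constant, contradicting `hEP`.
    obtain rfl : algebraMap K F ((a + 4) / 3) = c := by
      rw [map_div₀, map_add, ha, map_ofNat, map_ofNat]
      field_simp
      ring
    refine hEP (EllDiv.isConstantPair_of_diagonalCurve h2 h3 E P ?_ ?_ φ hφ hns hc)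
    · intro h
      exact hc₀ (by rw [h, map_zero])
    · intro h
      exact hc₁ (by rw [h, map_one])
  obtain ⟨hess, hΩ⟩ := hF.finrank_kaehlerDifferential
  obtain ⟨v, hv⟩ := EllDiv.Place.exists_mem_nonunits hΩ hs
  exact ⟨v, EllDiv.isPrimitiveValuation_three h2 h3 E P hc₀ hc₁ φ hφ hns hc v hv
    fun h => hs (h ▸ isAlgebraic_zero)⟩
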